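/- **Theorem 3.** Consider a decision tree of depth $d$ whose complete branches (leaves) form a non-empty set $I\subseteq\prod_{k=1}^d\{1,\dots,N_k\}$, and let $\mathbf T:I\to\mathbb R$ be the true leaf values. Let $\mathcal Q$ be any tensor-train model, i.e. $\mathcal Q(i_1,\dots,i_d)=\mathcal Q^1_{:,i_1,:}\cdots\mathcal Q^d_{:,i_d,:}$ with cores of ranks $r_0=1,r_1,\dots,r_d=1$. Each evaluation of a leaf $x\in I$ returns a reward; the successive rewards of $x$ are integrable, identically distributed and pairwise independent with mean $\mathbf T(x)$ (exact evaluation, where every reward equals $\mathbf T(x)$, is a special case). Let $c>0$ and $\tau\ge 1$. Tensor Train Tree Search (TTTS) keeps for every node $p$ a visit count $v_p$, initially $0$, and a cumulative reward $w_p$, initially the sum of $\mathcal Q$ over all completions of $p$ to a full multi-index (so $w_x=\mathcal Q(x)$ at a leaf). In each iteration, starting from the root, it selects in each layer, among the children of the expanded nodes selected in the layer above (a non-root node is expanded once it has been visited in an earlier iteration), the $\tau$ nodes $p$ with the largest upper confidence bounds $$\mathrm{UCB}(p)=\frac{w_p}{v_p}+c\sqrt{\frac{\log v_{\mathrm{parent}(p)}}{v_p}}\qquad(\mathrm{UCB}(p)=+\infty\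 \text{if } v_p=0),$$ or all of them if there are fewer, ties being broken arbitrarily. From every selected node that is a leaf or not yet expanded, one completion in $I$ is simulated (by any rollout policy) and its leaf is evaluated. Finally every selected node gets one more visit, and the rewards of the leaves below it that were evaluated in this iteration are added to its cumulative reward. Let $\widehat Q_l(x)$ be the value $w_x/v_x$ of the leaf $x$ after $l$ iterations (and $\mathcal Q(x)$ as long as $v_x=0$). Then, for every tensor-train model $\mathcal Q$, TTTS retains the asymptotic global convergence of Monte Carlo Tree Search. Almost surely, 1. every node of the tree is visited infinitely often; 2. $\displaystyle\lim_{l\to\infty}\max_{x\in I}\bigl|\widehat Q_l(x)-\mathbf T(x)\bigr|=0$; 3. for all sufficiently large $l$, $\arg\max_{x\in I}\widehat Q_l(x)\subseteq\arg\max_{x\in I}\mathbf T(x)$. Moreover, the initialization does not change the UCB exploration mechanism: for every history of selections, simulations and rewards, the initialization with $\mathcal Q$ and the plain initialization with $0$ give the same visit counts, hence the same exploration terms $c\sqrt{\log v_{\mathrm{parent}(p)}/v_p}$, and the same infinite priority of unvisited nodes; at every visited non-root node $p$ the upper confidence bounds differ exactly by $w_p^0/v_p$ in the exploitation term, where $w^0_p$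 is the sum of $\mathcal Q$ over the completions of $p$. -/

import Mathlib

open MeasureTheory ProbabilityTheory Filter Topology

namespace TTTS

/-- Complete branches of a decision tree of depth `d` whose layer `k` offers `N k` choices; these are
the multi-indices of a tensor of size `N 0 × ⋯ × N (d-1)`. -/
abbrev Leaf {d : ℕ} (N : Fin d → ℕ) : Type := (k : Fin d) → Fin (N k)

/-- Partial branches of length `j` (for `j ≤ d`): the choices made in the layers before `j`. -/
abbrev Prefix {d : ℕ} (N : Fin d → ℕ) (j : ℕ) : Type :=
  (k : Fin d) → (k : ℕ) < j → Fin (N k)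

/-- A tensor-train model: ranks `r₀ = 1, r₁, …, r_d = 1`, and for each layer a core, whose slices are
`r_k × r_{k+1}` matrices. -/
structure TTModel {d : ℕ} (N : Fin d → ℕ) where
  rank : ℕ → ℕ
  rank_zero : rank 0 = 1
  rank_last : rank d = 1
  core : (k : Fin d) → Fin (N k) → Matrix (Fin (rank k)) (Fin (rank (k + 1))) ℝ

section
variable {d : ℕ} {N : Fin d → ℕ}

/-- The product of the first `j` core slices selected by `x`. -/
def TTModel.partialProd (M : TTModel N) (x : Leaf N) :
    (j : ℕ) → j ≤ d → Matrix (Fin (M.rank 0)) (Fin (M.rank j)) ℝ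
  | 0, _ => 1
  | j + 1, h => M.partialProd x j (Nat.le_of_succ_le h) * M.core ⟨j, h⟩ (x ⟨j, h⟩)

/-- The tensor entry represented by a tensor-train model: the (one by one) product of the selected
slices of all the cores. -/
def TTModel.eval (M : TTModel N) (x : Leaf N) : ℝ :=
  M.partialProd x d le_rfl ⟨0, by rw [M.rank_zero]; exact one_pos⟩
    ⟨0, by rw [M.rank_last]; exact one_pos⟩

/-- The node at depth `j` on the branch `x`. -/
def take (j : ℕ) (x : Leaf N) : Prefix N j := fun k _ => x k

/-- The parent of a node. -/
def parent {j : ℕ} (p : Prefix N (j + 1)) : Prefix N j := fun k hk => p k (Nat.lt_succ_of_lt hk)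

open Classical in
/-- The nodes at depth `j` of the tree whose set of complete branches is `I`. -/
noncomputable def layer (I : Finset (Leaf N)) (j : ℕ) : Finset (Prefix N j) := I.image (take j)

open Classical in
/-- The sum of the tensor `Q` over all completions of the partial branch `p`. -/
noncomputable def completionSum (Q : Leaf N → ℝ) (j : ℕ) (p : Prefix N j) : ℝ :=
  ∑ x : Leaf N, if take j x = p then Q x else 0

/-- The statistics kept by the search: the visit count and the cumulative reward of every node, and
the number of times that each complete branch has been evaluated. -/
structure State (N : Fin d → ℕ) where
  visits : (j : ℕ) → Prefix N j → ℕ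
  reward : (j : ℕ) → Prefix N j → ℝ
  evals : Leaf N → ℕ

/-- The state before the first iteration: no visits, and node values obtained by summing the initial
value tensor `Q` over completions (so that the leaf `x` has the value `Q x`). -/
noncomputable def initial (Q : Leaf N → ℝ) : State N where
  visits := fun _ _ => 0
  reward := completionSum Q
  evals := fun _ => 0

/-- The upper confidence bound of a non-root node; an unvisited node has infinite priority. -/
noncomputable def ucb (c : ℝ) (s : State N) (j : ℕ) (p : Prefix N (j + 1)) : EReal :=
  if s.visits (j + 1) p = 0 then ⊤
  else ((s.reward (j + 1) p / s.visits (j + 1) p +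
    c * √(Real.log (s.visits j (parent p)) / s.visits (j + 1) p) : ℝ) : EReal)

/-- The root is expanded from the start, and any other node at its first visit. -/
def Expanded (s : State N) (j : ℕ) (p : Prefix N j) : Prop := j = 0 ∨ 0 < s.visits j p

/-- Selection stops at the bottom of the tree and at nodes that are not expanded yet. -/
def Terminal (s : State N) (j : ℕ) (p : Prefix N j) : Prop := j = d ∨ ¬ Expanded s j p

/-- The choices made in one iteration: the nodes selected in each layer, and the complete branch that
is simulated (rolled out) from each node where selection stops. -/
structure Iteration (N : Fin d → ℕ) where
  beam : (j : ℕ) → Finset (Prefix N j)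
  sim : (j : ℕ) → Prefix N j → Leaf N

open Classical in
/-- The nodes at depth `j + 1` that can be selected: the children of the expanded nodes that are
selected at depth `j`. -/
noncomputable def candidates (I : Finset (Leaf N)) (s : State N) (it : Iteration N) (j : ℕ) :
    Finset (Prefix N (j + 1)) :=
  (layer I (j + 1)).filter fun p => parent p ∈ it.beam j ∧ Expanded s j (parent p)

/-- `it` is an iteration of the search from the state `s`: starting at the root, in each layer `τ`
candidates with the largest upper confidence bounds are selected (all of them, if there are fewer),
ties being broken in any way; from each node where selection stops, some completion is simulated, chosen
by any rollout policy. For `τ = 1` a single path is selected, as in plain tree search. -/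
structure IsSearchIteration (I : Finset (Leaf N)) (c : ℝ) (τ : ℕ) (s : State N)
    (it : Iteration N) : Prop where
  root : it.beam 0 = Finset.univ
  subset : ∀ j < d, it.beam (j + 1) ⊆ candidates I s it j
  card : ∀ j < d, (it.beam (j + 1)).card = min τ (candidates I s it j).card
  best : ∀ j < d, ∀ a ∈ candidates I s it j, a ∉ it.beam (j + 1) →
    ∀ b ∈ it.beam (j + 1), ucb c s j a ≤ ucb c s j b
  sim_mem : ∀ j ≤ d, ∀ p ∈ it.beam j, Terminal s j p →
    it.sim j p ∈ I ∧ take j (it.sim j p) = p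

open Classical in
/-- The complete branches evaluated in an iteration. -/
noncomputable def evaluated (s : State N) (it : Iteration N) : Finset (Leaf N) :=
  Finset.univ.filter fun x => ∃ j ≤ d, ∃ p ∈ it.beam j, Terminal s j p ∧ it.sim j p = x

open Classical in
/-- Backpropagation: every selected node is credited with one visit and with the rewards of the
evaluated branches through it. The reward of an evaluation of `x` is `ρ x k`, where `k` is the number of
earlier evaluations of `x`. -/
noncomputable def step (ρ : Leaf N → ℕ → ℝ) (s : State N) (it : Iteration N) : State N where
  visits := fun j p => s.visits j p + if p ∈ it.beam j then 1 else 0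
  reward := fun j p => s.reward j p +
    if p ∈ it.beam j then
      ∑ x ∈ (evaluated s it).filter (fun x => take j x = p), ρ x (s.evals x)
    else 0
  evals := fun x => s.evals x + if x ∈ evaluated s it then 1 else 0

/-- The state after `l` iterations with initial value tensor `Q`. -/
noncomputable def run (Q : Leaf N → ℝ) (ρ : Leaf N → ℕ → ℝ) (it : ℕ → Iteration N) : ℕ → State N
  | 0 => initial Q
  | l + 1 => step ρ (run Q ρ it l) (it l)

/-- The value estimate of the leaf `x`: cumulative reward over visit count, and the initial value as
long as there is no visit. -/
noncomputable def estimate (s : State N) (x : Leaf N) : ℝ :=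
  if s.visits d (take d x) = 0 then s.reward d (take d x)
  else s.reward d (take d x) / s.visits d (take d x)

end

end TTTS

/-!
Suppose that the average of the rewards of every leaf converges. Then the exploitation terms stay
bounded, so selection by upper confidence bounds compares the ratios `log v_parent / v` up to a
constant factor once they are large. Call a child starved if its ratio is large. At every time when
the parent of a starved child is selected, some starved node is selected. Take a starved child whose
parent has `m` visits: over the last `m - √m` of these, the ratio of that child is at least half of
its final value, hence starved nodes are selected `m - √m` times. A starved node whose parent has at
most `m` visits has itself only `O(log m)` of them, so, for `m` large, one of the selected starved
nodes has a parent with more than `m` visits. Repeating this with that node would produce more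
parents than there are, if the first child is starved enough. Therefore the visits of a node are at
least a positive multiple of the logarithm of the visits of its parent, and by induction on the
depth every node is visited infinitely often.

Once every node that is ever selected above the leaves is expanded, a leaf is evaluated exactly when
it is selected, so its estimate has the same limit as the average of its rewards, which is given by
the strong law of large numbers. The initial values only add a constant to each cumulative reward,
and the visit counts do not see them.
-/

namespace TTTS

section Selection

variable {α β : Type*}

open scoped Classical in
/-- The number of times before `t` at which `a` is selected, when the set `sel s` is selected at
each time `s`: the visit count of a node, for the sets of nodes selected in one layer of the tree.
-/
noncomputable def selectionCount (sel : ℕ → Finset α) (t : ℕ) (a : α) : ℕ :=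
  Nat.count (fun s => a ∈ sel s) t

open scoped Classical in
theorem selectionCount_succ (sel : ℕ → Finset α) (t : ℕ) (a : α) :
    selectionCount sel (t + 1) a = selectionCount sel t a + if a ∈ sel t then 1 else 0 :=
  Nat.count_succ _ _

theorem selectionCount_mono (sel : ℕ → Finset α) (a : α) :
    Monotone fun t => selectionCount sel t a := by
  classical
  exact Nat.count_monotone _

theorem selectionCount_le_selectionCount {sel : ℕ → Finset α} {sel' : ℕ → Finset β} {a : α} {b : β}
    (h : ∀ t, a ∈ sel t → b ∈ sel' t) (t : ℕ) :
    selectionCount sel t a ≤ selectionCount sel' t b := by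
  classical
  exact Nat.count_mono_left fun s _ => h s

theorem eventually_selectionCount_pos (sel : ℕ → Finset α) (a : α) :
    ∀ᶠ t in atTop, a ∈ sel t → 0 < selectionCount sel t a := by
  by_cases ha : ∃ s, a ∈ sel s
  · obtain ⟨s, hs⟩ := ha
    filter_upwards [eventually_gt_atTop s] with t ht _
    calc 0 < selectionCount sel (s + 1) a := by simp [selectionCount_succ, hs]
      _ ≤ selectionCount sel t a := selectionCount_mono sel a ht
  · exact Eventually.of_forall fun t ht => absurd ⟨t, ht⟩ ha

/-- Distinct times at which the same element is selected are told apart by its count. -/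
theorem card_le_card_mul_of_exists_selectionCount_lt {sel : ℕ → Finset α} {A : Finset α}
    {F : Finset ℕ} {k : ℕ} (h : ∀ s ∈ F, ∃ a ∈ A, a ∈ sel s ∧ selectionCount sel s a < k) :
    F.card ≤ A.card * k := by
  classical
  rcases isEmpty_or_nonempty α with _ | _
  · have : F = ∅ := Finset.eq_empty_of_forall_notMem fun s hs => isEmptyElim (h s hs).choose
    simp [this]
  choose! g hgA hg hlt using h
  rw [← Finset.card_range k, ← Finset.card_product]
  refine Finset.card_le_card_of_injOn (fun s => (g s, selectionCount sel s (g s))) ?_ ?_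
  · intro s hs
    simpa using ⟨hgA s hs, hlt s hs⟩
  · intro s hs t ht hst
    obtain ⟨hg_eq, hcount⟩ := Prod.ext_iff.1 hst
    simp only at hg_eq hcount
    rw [← hg_eq] at hcount
    exact Nat.count_injective (p := fun r => g s ∈ sel r) (hg s hs) (hg_eq ▸ hg t ht) hcount

open scoped Classical in
theorem selectionCount_le_card_add (sel : ℕ → Finset α) (t q : ℕ) (a : α) :
    selectionCount sel t a ≤
      ((Finset.range t).filter fun s => a ∈ sel s ∧ q ≤ selectionCount sel s a).card + q := by
  have hfirst : ((Finset.range t).filter fun s => a ∈ sel s ∧ ¬ q ≤ selectionCount sel s a).card ≤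
      ({a} : Finset α).card * q :=
    card_le_card_mul_of_exists_selectionCount_lt (sel := sel) fun s hs => by
      simpa using (Finset.mem_filter.1 hs).2
  rw [Finset.card_singleton, one_mul] at hfirst
  calc selectionCount sel t a = ((Finset.range t).filter fun s => a ∈ sel s).card :=
        Nat.count_eq_card_filter_range _ _
    _ = _ := by
        rw [← Finset.card_filter_add_card_filter_not (fun s => q ≤ selectionCount sel s a),
          Finset.filter_filter, Finset.filter_filter]
    _ ≤ _ := by gcongr

end Selection

section Starvation

variable {α β : Type*} {par : α → β}

/-- With visit counts `v` of the children and `w` of the parents, the squared exploration ratio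
`log w / v` of the child `a` is at least `L`. The inequality is multiplied out so that an unvisited
child is starved at every level. -/
def Starved (par : α → β) (v : α → ℕ) (w : β → ℕ) (L : ℝ) (a : α) : Prop :=
  L * v a ≤ Real.log (w (par a))

theorem log_natCast_mono : Monotone fun n : ℕ => Real.log n := by
  intro m n hmn
  rcases Nat.eq_zero_or_pos m with rfl | hm
  · simpa using Real.log_natCast_nonneg n
  · exact Real.log_le_log (by exact_mod_cast hm) (by exact_mod_cast hmn)

theorem log_natCast_le_two_mul_log_of_le_sq {m n : ℕ} (h : m ≤ n ^ 2) :
    Real.log m ≤ 2 * Real.log n := by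
  simpa [Real.log_pow] using log_natCast_mono h

/-- The level is only halved because a square root only halves the logarithm. -/
theorem Starved.half_of_le_sq {v v' : α → ℕ} {w w' : β → ℕ} {L : ℝ} {a : α}
    (h : Starved par v w L a) (hL : 0 ≤ L) (hv : v' a ≤ v a) (hw : w (par a) ≤ w' (par a) ^ 2) :
    Starved par v' w' (L / 2) a := by
  have hlog := log_natCast_le_two_mul_log_of_le_sq hw
  have hmul : L * v' a ≤ L * v a := by gcongr
  unfold Starved at h ⊢
  linarith

/-- Selection favours starved nodes up to a constant factor: when the parent of a node starved at a
level `L ≥ L₀` is selected, some node starved at level `L / 4` is selected. The node selected need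
not be a child of that parent, since all the children of selected nodes compete. -/
structure FavorsStarved (par : α → β) (node : Set α) (sel : ℕ → Finset α) (beam : ℕ → Finset β)
    (L₀ : ℝ) : Prop where
  subset_node : ∀ t, (sel t : Set α) ⊆ node
  favors : ∀ L, L₀ ≤ L → ∀ t, ∀ a ∈ node, par a ∈ beam t → 0 < selectionCount beam t (par a) →
    Starved par (selectionCount sel t) (selectionCount beam t) L a →
      ∃ b ∈ sel t, Starved par (selectionCount sel t) (selectionCount beam t) (L / 4) b

variable {node : Set α} {sel : ℕ → Finset α} {beam : ℕ → Finset β} {L₀ L : ℝ} {t : ℕ} {b : α}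

theorem FavorsStarved.exists_mem_starved_of_le (h : FavorsStarved par node sel beam L₀)
    (hL₀ : 2 * L₀ ≤ L) (hL : 0 ≤ L) (hb : b ∈ node)
    (hst : Starved par (selectionCount sel t) (selectionCount beam t) L b) {s : ℕ} (hs : s ≤ t)
    (hpar : par b ∈ beam s) (hpos : 0 < selectionCount beam s (par b))
    (hsq : selectionCount beam t (par b) ≤ selectionCount beam s (par b) ^ 2) :
    ∃ a ∈ sel s, Starved par (selectionCount sel s) (selectionCount beam s) (L / 8) a := by
  obtain ⟨a, ha, hst'⟩ := h.favors (L / 2) (by linarith) s b hb hpar hpos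
    (hst.half_of_le_sq hL (selectionCount_mono sel b hs) hsq)
  exact ⟨a, ha, by convert hst' using 1; ring⟩

theorem exists_le_sq_and_mul_lt {n m : ℕ} (hm : (2 * n + 3) ^ 2 ≤ m) :
    ∃ q, m ≤ q ^ 2 ∧ (2 * n + 1) * q < m := by
  have hsqrt : 2 * n + 3 ≤ Nat.sqrt m := Nat.le_sqrt'.2 hm
  refine ⟨Nat.sqrt m + 1, (Nat.lt_succ_sqrt' m).le, ?_⟩
  nlinarith [Nat.sqrt_le' m]

/-- Otherwise only `O(log m)` visits of a starved node fit into the last `m - √m` visits of `par b`,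
where `m` is the number of visits of `par b`, although each of these visits selects one. -/
theorem FavorsStarved.exists_starved_of_starved [Fintype α] (h : FavorsStarved par node sel beam L₀)
    (hL₀ : 2 * L₀ ≤ L) (hL : 8 ≤ L) (hb : b ∈ node)
    (hst : Starved par (selectionCount sel t) (selectionCount beam t) L b)
    (hm : (2 * Fintype.card α + 3) ^ 2 ≤ selectionCount beam t (par b)) :
    ∃ s ≤ t, ∃ a ∈ node, Starved par (selectionCount sel s) (selectionCount beam s) (L / 8) a ∧
      selectionCount beam t (par b) < selectionCount beam s (par a) := by
  classical
  by_contra! hcon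
  set m := selectionCount beam t (par b)
  obtain ⟨q, hq, hlt⟩ := exists_le_sq_and_mul_lt hm
  have hq0 : 0 < q := by
    by_contra! hq0
    simp_all
  have hlog : Real.log m < (2 * q : ℕ) := by
    have := Real.log_le_sub_one_of_pos (Nat.cast_pos.2 hq0)
    push_cast
    linarith [log_natCast_le_two_mul_log_of_le_sq hq]
  have hlate : ∀ s ∈ (Finset.range t).filter
      (fun s => par b ∈ beam s ∧ q ≤ selectionCount beam s (par b)),
      ∃ a ∈ Finset.univ, a ∈ sel s ∧ selectionCount sel s a < 2 * q := by
    intro s hs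
    obtain ⟨hst', hpar, hqs⟩ : s < t ∧ par b ∈ beam s ∧ q ≤ selectionCount beam s (par b) := by
      simpa using hs
    obtain ⟨a, ha, hsta⟩ := h.exists_mem_starved_of_le hL₀ (by linarith) hb hst hst'.le hpar
      (hq0.trans_le hqs) (hq.trans (Nat.pow_le_pow_left hqs 2))
    refine ⟨a, Finset.mem_univ a, ha, ?_⟩
    have hle := log_natCast_mono (hcon s hst'.le a (h.subset_node s ha) hsta)
    have hone : 1 * (selectionCount sel s a : ℝ) ≤ L / 8 * selectionCount sel s a := by
      gcongr
      linarith
    unfold Starved at hsta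
    exact_mod_cast (by linarith : (selectionCount sel s a : ℝ) < (2 * q : ℕ))
  have hcard := card_le_card_mul_of_exists_selectionCount_lt hlate
  rw [Finset.card_univ] at hcard
  have hsplit := selectionCount_le_card_add beam t q (par b)
  lia

theorem FavorsStarved.lt_card_filter_le [Fintype α] [Fintype β]
    (h : FavorsStarved par node sel beam L₀) (hL₀ : 2 * L₀ ≤ L) (hL : 8 ≤ L) (k : ℕ) (hb : b ∈ node)
    (hst : Starved par (selectionCount sel t) (selectionCount beam t) (8 ^ k * L) b)
    (hm : (2 * Fintype.card α + 3) ^ 2 ≤ selectionCount beam t (par b)) :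
    k < (Finset.univ.filter fun p =>
      selectionCount beam t (par b) ≤ selectionCount beam t p).card := by
  induction k generalizing t b with
  | zero => exact Finset.card_pos.2 ⟨par b, by simp⟩
  | succ k ih =>
    have hle : L ≤ 8 ^ (k + 1) * L :=
      le_mul_of_one_le_left (by linarith) (one_le_pow₀ (by norm_num))
    obtain ⟨s, hs, a, ha, hsta, hlt⟩ :=
      h.exists_starved_of_starved (hL₀.trans hle) (hL.trans hle) hb hst hm
    have hk := ih ha (by convert hsta using 1; ring) (hm.trans hlt.le)
    refine (Nat.succ_le_of_lt hk).trans_lt (Finset.card_lt_card ?_)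
    rw [Finset.ssubset_iff_of_subset]
    · exact ⟨par b, by simp, by simpa using (selectionCount_mono beam (par b) hs).trans_lt hlt⟩
    · intro p hp
      simp only [Finset.mem_filter, Finset.mem_univ, true_and] at hp ⊢
      exact hlt.le.trans (hp.trans (selectionCount_mono beam p hs))

theorem FavorsStarved.exists_log_le_mul [Finite α] [Finite β]
    (h : FavorsStarved par node sel beam L₀) :
    ∃ D > 0, ∃ B, ∀ t, ∀ b ∈ node, B ≤ selectionCount beam t (par b) →
      Real.log (selectionCount beam t (par b)) ≤ D * selectionCount sel t b := by
  have := Fintype.ofFinite α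
  have := Fintype.ofFinite β
  refine ⟨8 ^ Fintype.card β * max (2 * L₀) 8, by positivity, (2 * Fintype.card α + 3) ^ 2,
    fun t b hb hm => ?_⟩
  by_contra! hst
  exact absurd (h.lt_card_filter_le (le_max_left _ _) (le_max_right _ _) _ hb hst.le hm)
    (Finset.card_le_univ _).not_gt

theorem FavorsStarved.tendsto_selectionCount [Finite α] [Finite β]
    (h : FavorsStarved par node sel beam L₀) (hb : b ∈ node)
    (hpar : Tendsto (fun t => selectionCount beam t (par b)) atTop atTop) :
    Tendsto (fun t => selectionCount sel t b) atTop atTop := by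
  obtain ⟨D, hD, B, hB⟩ := h.exists_log_le_mul
  have hlog : Tendsto (fun t => Real.log (selectionCount beam t (par b))) atTop atTop :=
    Real.tendsto_log_atTop.comp (tendsto_natCast_atTop_atTop.comp hpar)
  have hmul : Tendsto (fun t => D * (selectionCount sel t b : ℝ)) atTop atTop :=
    tendsto_atTop_mono' _ ((hpar.eventually_ge_atTop B).mono fun t ht => hB t b hb ht) hlog
  exact tendsto_natCast_atTop_iff.1 ((tendsto_const_mul_atTop_of_pos hD).1 hmul)

end Starvation

section Limits

open Asymptotics

variable {ι X : Type*} {l : Filter ι}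

theorem tendsto_div_of_eventuallyConst_sub {u v w : ι → ℝ} {a : ℝ} (hw : Tendsto w l atTop)
    (huv : EventuallyConst (fun i => u i - v i) l) (hv : Tendsto (fun i => v i / w i) l (𝓝 a)) :
    Tendsto (fun i => u i / w i) l (𝓝 a) := by
  obtain ⟨C, hC⟩ := eventuallyConst_iff_exists_eventuallyEq.1 huv
  have hsum : Tendsto (fun i => v i / w i + C / w i) l (𝓝 a) := by
    simpa using hv.add (hw.const_div_atTop C)
  refine hsum.congr' (hC.mono fun i hi => ?_)
  simp only at hi ⊢
  rw [← add_div, ← hi, add_sub_cancel]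

theorem tendsto_atTop_of_eventuallyConst_sub {u v : ι → ℝ} (hv : Tendsto v l atTop)
    (huv : EventuallyConst (fun i => u i - v i) l) : Tendsto u l atTop := by
  obtain ⟨C, hC⟩ := eventuallyConst_iff_exists_eventuallyEq.1 huv
  refine (tendsto_atTop_add_const_right l C hv).congr' (hC.mono fun i hi => ?_)
  simp only at hi
  rw [← hi, add_sub_cancel]

theorem isBigO_top_natCast_of_tendsto_div {u : ℕ → ℝ} {a : ℝ} (hu : u 0 = 0)
    (h : Tendsto (fun n => u n / n) atTop (𝓝 a)) : u =O[⊤] fun n => (n : ℝ) := by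
  have hzero : ∀ n : ℕ, (n : ℝ) = 0 → u n = 0 := fun n hn => by rw [Nat.cast_eq_zero.1 hn, hu]
  exact (isBigO_of_div_tendsto_nhds (Eventually.of_forall hzero) a h).nat_of_atTop
    (Eventually.of_forall hzero)

theorem exists_abs_div_le_of_isBigO_add_one {u : ℕ → ℝ} {v : ℕ → ℕ}
    (h : u =O[atTop] fun l => (v l : ℝ) + 1) : ∃ W, ∀ l, |u l / v l| ≤ W := by
  obtain ⟨C, hC, hbound⟩ := h.exists_nonneg
  have hdiv : (fun l => u l / v l) =O[atTop] (fun _ => 1 : ℕ → ℝ) := by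
    refine IsBigO.of_bound (2 * C) (hbound.bound.mono fun l hl => ?_)
    rw [norm_div, Real.norm_natCast, norm_one, mul_one]
    rcases Nat.eq_zero_or_pos (v l) with h0 | h0
    · simpa [h0] using hC
    · have h1 : (1 : ℝ) ≤ v l := by exact_mod_cast h0
      rw [Real.norm_of_nonneg (by positivity : (0 : ℝ) ≤ v l + 1)] at hl
      rw [div_le_iff₀ (by positivity)]
      nlinarith
  exact isBigO_one_nat_atTop_iff.1 hdiv

theorem tendsto_sup'_abs_sub {s : Finset X} (hs : s.Nonempty) {f : ι → X → ℝ} {T : X → ℝ}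
    (h : ∀ x ∈ s, Tendsto (fun i => f i x) l (𝓝 (T x))) :
    Tendsto (fun i => s.sup' hs fun x => |f i x - T x|) l (𝓝 0) := by
  rw [← Finset.sup'_const hs (0 : ℝ)]
  refine Tendsto.finset_sup'_nhds_apply hs fun x hx => ?_
  simpa using ((h x hx).sub_const (T x)).abs

theorem eventually_isMaxOn_of_tendsto {R : Type*} [LinearOrder R] [TopologicalSpace R]
    [OrderClosedTopology R] {s : Finset X} {f : ι → X → R} {T : X → R}
    (h : ∀ x ∈ s, Tendsto (fun i => f i x) l (𝓝 (T x))) :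
    ∀ᶠ i in l, ∀ x ∈ s, IsMaxOn (f i) (s : Set X) x → IsMaxOn T (s : Set X) x := by
  have hlt : ∀ᶠ i in l, ∀ x ∈ s, ∀ y ∈ s, T x < T y → f i x < f i y := by
    simp only [Finset.eventually_all, eventually_imp_distrib_left]
    exact fun x hx y hy hxy => (h x hx).eventually_lt (h y hy) hxy
  filter_upwards [hlt] with i hi x hx hmax y hy
  exact le_of_not_gt fun hxy => (hi x hx y hy hxy).not_ge (hmax hy)

theorem ae_tendsto_average {Ω : Type*} [MeasurableSpace Ω] {μ : Measure Ω} {s : Set X}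
    (hs : s.Countable) {R : X → ℕ → Ω → ℝ} {T : X → ℝ} (hint : ∀ x ∈ s, Integrable (R x 0) μ)
    (hindep : ∀ x ∈ s, Pairwise fun k m => IndepFun (R x k) (R x m) μ)
    (hident : ∀ x ∈ s, ∀ k, IdentDistrib (R x k) (R x 0) μ μ)
    (hmean : ∀ x ∈ s, ∫ ω, R x 0 ω ∂μ = T x) :
    ∀ᵐ ω ∂μ, ∀ x ∈ s,
      Tendsto (fun n : ℕ => (∑ k ∈ Finset.range n, R x k ω) / n) atTop (𝓝 (T x)) := by
  refine (ae_ball_iff hs).2 fun x hx => ?_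
  rw [← hmean x hx]
  exact strong_law_ae_real (R x) (hint x hx) (hindep x hx) (hident x hx)

end Limits

section Iteration

variable {d : ℕ} {N : Fin d → ℕ} {I : Finset (Leaf N)} {c : ℝ} {τ j : ℕ} {s : State N}
  {i : Iteration N}

theorem take_depth_injective : Function.Injective (take d : Leaf N → Prefix N d) :=
  fun _ _ h => funext fun k => congrFun (congrFun h k) k.2

theorem mem_candidates {p : Prefix N (j + 1)} :
    p ∈ candidates I s i j ↔
      p ∈ layer I (j + 1) ∧ parent p ∈ i.beam j ∧ Expanded s j (parent p) := by
  simp [candidates]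

theorem mem_evaluated {x : Leaf N} :
    x ∈ evaluated s i ↔ ∃ j ≤ d, ∃ p ∈ i.beam j, Terminal s j p ∧ i.sim j p = x := by
  simp [evaluated]

theorem IsSearchIteration.take_mem_beam (h : IsSearchIteration I c τ s i) {k : ℕ} (hjk : j ≤ k)
    (hk : k ≤ d) {x : Leaf N} (hx : take k x ∈ i.beam k) : take j x ∈ i.beam j := by
  induction k, hjk using Nat.le_induction with
  | base => exact hx
  | succ k _ ih => exact ih (by lia) (mem_candidates.1 (h.subset k hk hx)).2.1

theorem IsSearchIteration.evaluated_subset (h : IsSearchIteration I c τ s i) :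
    evaluated s i ⊆ I := by
  intro x hx
  obtain ⟨k, hk, p, hp, hterm, rfl⟩ := mem_evaluated.1 hx
  exact (h.sim_mem k hk p hp hterm).1

theorem IsSearchIteration.mem_evaluated_iff (h : IsSearchIteration I c τ s i)
    (hexp : ∀ k < d, ∀ p ∈ i.beam k, Expanded s k p) {x : Leaf N} :
    x ∈ evaluated s i ↔ take d x ∈ i.beam d := by
  rw [mem_evaluated]
  constructor
  · rintro ⟨k, hk, p, hp, hterm, rfl⟩
    obtain rfl : k = d := hk.eq_or_lt.resolve_right fun hlt =>
      hterm.elim hlt.ne (absurd (hexp k hlt p hp))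
    rwa [(h.sim_mem k hk p hp hterm).2]
  · intro hx
    have hterm : Terminal s d (take d x) := Or.inl rfl
    exact ⟨d, le_rfl, take d x, hx, hterm,
      take_depth_injective (h.sim_mem d le_rfl _ hx hterm).2⟩

open scoped Classical in
theorem IsSearchIteration.evals_step (h : IsSearchIteration I c τ s i)
    (hexp : ∀ k < d, ∀ p ∈ i.beam k, Expanded s k p) (ρ : Leaf N → ℕ → ℝ) (x : Leaf N) :
    (step ρ s i).evals x = s.evals x + if take d x ∈ i.beam d then 1 else 0 := by
  simp only [step, h.mem_evaluated_iff hexp]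

open scoped Classical in
theorem IsSearchIteration.reward_step (h : IsSearchIteration I c τ s i)
    (hexp : ∀ k < d, ∀ p ∈ i.beam k, Expanded s k p) (ρ : Leaf N → ℕ → ℝ) (hj : j ≤ d)
    (p : Prefix N j) :
    (step ρ s i).reward j p = s.reward j p +
      ∑ x ∈ I with take j x = p, if take d x ∈ i.beam d then ρ x (s.evals x) else 0 := by
  have hfilter : (evaluated s i).filter (fun x => take j x = p) =
      (I.filter fun x => take j x = p).filter fun x => take d x ∈ i.beam d := by
    ext x
    have hI : x ∈ evaluated s i → x ∈ I := fun hx => h.evaluated_subset hx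
    rw [h.mem_evaluated_iff hexp] at hI
    simp only [Finset.mem_filter, h.mem_evaluated_iff hexp]
    tauto
  rw [← Finset.sum_filter, ← hfilter]
  simp only [step]
  split_ifs with hp
  · rfl
  · rw [Finset.filter_eq_empty_iff.2 fun x hx hxp => hp ?_, Finset.sum_empty]
    exact hxp ▸ h.take_mem_beam hj le_rfl ((h.mem_evaluated_iff hexp).1 hx)

theorem IsSearchIteration.exists_ucb_le (h : IsSearchIteration I c τ s i) (hτ : 1 ≤ τ) (hj : j < d)
    {a : Prefix N (j + 1)} (ha : a ∈ candidates I s i j) :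
    ∃ b ∈ i.beam (j + 1), ucb c s j a ≤ ucb c s j b := by
  by_cases hsel : a ∈ i.beam (j + 1)
  · exact ⟨a, hsel, le_rfl⟩
  · have hcard : 0 < (i.beam (j + 1)).card := by
      rw [h.card j hj]
      exact lt_min hτ (Finset.card_pos.2 ⟨a, ha⟩)
    obtain ⟨b, hb⟩ := Finset.card_pos.1 hcard
    exact ⟨b, hb, h.best j hj a ha hsel b hb⟩

/-- The threshold on `L` makes the exploration term of `a` at least `4 * W`, so that giving up
`2 * W` for the two exploitation terms leaves at least half of it to `b`. -/
theorem Starved.of_ucb_le (hc : 0 < c) {W : ℝ}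
    (hW : ∀ p, |s.reward (j + 1) p / s.visits (j + 1) p| ≤ W) {L : ℝ} (hL : (4 * W / c) ^ 2 ≤ L)
    {a b : Prefix N (j + 1)} (hab : ucb c s j a ≤ ucb c s j b)
    (ha : Starved parent (s.visits (j + 1)) (s.visits j) L a) :
    Starved parent (s.visits (j + 1)) (s.visits j) (L / 4) b := by
  unfold Starved at ha ⊢
  rcases Nat.eq_zero_or_pos (s.visits (j + 1) b) with hb0 | hb0
  · simpa [hb0] using Real.log_natCast_nonneg _
  rcases Nat.eq_zero_or_pos (s.visits (j + 1) a) with ha0 | ha0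
  · rw [ucb, if_pos ha0, ucb, if_neg hb0.ne', top_le_iff] at hab
    exact absurd hab (EReal.coe_ne_top _)
  rw [ucb, if_neg ha0.ne', ucb, if_neg hb0.ne', EReal.coe_le_coe_iff] at hab
  have ha' : (0 : ℝ) < s.visits (j + 1) a := by exact_mod_cast ha0
  have hb' : (0 : ℝ) < s.visits (j + 1) b := by exact_mod_cast hb0
  have hthreshold : 4 * W ≤ c * √L := (div_le_iff₀' hc).1 (Real.le_sqrt_of_sq_le hL)
  have hexplore : c * √L ≤ c * √(Real.log (s.visits j (parent a)) / s.visits (j + 1) a) := by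
    gcongr
    exact (le_div_iff₀ ha').2 ha
  have hsqrt : √(L / 4) = √L / 2 := by
    rw [Real.sqrt_div' L (by norm_num), show (4 : ℝ) = 2 ^ 2 by norm_num,
      Real.sqrt_sq (by norm_num)]
  have hle : √(L / 4) ≤ √(Real.log (s.visits j (parent b)) / s.visits (j + 1) b) := by
    refine le_of_mul_le_mul_left ?_ hc
    rw [hsqrt]
    linarith [(abs_le.1 (hW a)).1, (abs_le.1 (hW b)).2]
  rwa [Real.sqrt_le_sqrt_iff (div_nonneg (Real.log_natCast_nonneg _) hb'.le),
    le_div_iff₀ hb'] at hle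

end Iteration

section Run

variable {d : ℕ} {N : Fin d → ℕ} (Q : Leaf N → ℝ) (ρ : Leaf N → ℕ → ℝ) (it : ℕ → Iteration N)

theorem visits_run (l j : ℕ) :
    (run Q ρ it l).visits j = selectionCount (fun n => (it n).beam j) l := by
  funext p
  induction l with
  | zero => rfl
  | succ l ih =>
    simp only [run, step, selectionCount_succ, ih]
    congr

theorem visits_run_eq (l : ℕ) : (run Q ρ it l).visits = (run (fun _ => 0) ρ it l).visits :=
  funext fun j => by rw [visits_run, visits_run]

theorem evaluated_run_eq (l : ℕ) :
    evaluated (run Q ρ it l) = evaluated (run (fun _ => 0) ρ it l) := by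
  funext i
  ext x
  simp only [mem_evaluated, Terminal, Expanded, visits_run_eq Q]

theorem evals_run_eq (l : ℕ) : (run Q ρ it l).evals = (run (fun _ => 0) ρ it l).evals := by
  induction l with
  | zero => rfl
  | succ l ih => simp only [run, step, ih, evaluated_run_eq Q]

theorem reward_run_eq (l j : ℕ) (p : Prefix N j) :
    (run Q ρ it l).reward j p = (run (fun _ => 0) ρ it l).reward j p + completionSum Q j p := by
  induction l with
  | zero => simp [run, initial, completionSum]
  | succ l ih =>
    simp only [run, step, ih, evals_run_eq Q, evaluated_run_eq Q]
    ring

theorem ucb_run_eq (c : ℝ) (l j : ℕ) (p : Prefix N (j + 1)) :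
    ucb c (run Q ρ it l) j p = ucb c (run (fun _ => 0) ρ it l) j p +
      ((completionSum Q (j + 1) p / (run Q ρ it l).visits (j + 1) p : ℝ) : EReal) := by
  simp only [ucb, visits_run_eq Q, reward_run_eq Q]
  split_ifs with h
  · simp
  · rw [← EReal.coe_add]
    congr 1
    ring

theorem eventually_expanded :
    ∀ᶠ n in atTop, ∀ j < d, ∀ p ∈ (it n).beam j, Expanded (run Q ρ it n) j p := by
  have hpos : ∀ᶠ n in atTop, ∀ j ∈ Finset.range d, ∀ p ∈ (it n).beam j,
      0 < (run Q ρ it n).visits j p := by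
    simp only [visits_run]
    exact (Finset.eventually_all _).2 fun j _ =>
      eventually_all.2 fun p => eventually_selectionCount_pos (fun n => (it n).beam j) p
  exact hpos.mono fun n hn j hj p hp => Or.inr (hn j (Finset.mem_range.2 hj) p hp)

end Run

section Search

open Asymptotics

variable {d : ℕ} {N : Fin d → ℕ} {I : Finset (Leaf N)} {c : ℝ} {τ j : ℕ} {Q : Leaf N → ℝ}
  {ρ : Leaf N → ℕ → ℝ} {it : ℕ → Iteration N} {T : Leaf N → ℝ} {x : Leaf N}

/-- A run of the search: with initial values `Q` and rewards `ρ`, every step of the history `it`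
makes choices that the search allows in the state reached so far. -/
def IsSearchRun (I : Finset (Leaf N)) (c : ℝ) (τ : ℕ) (Q : Leaf N → ℝ) (ρ : Leaf N → ℕ → ℝ)
    (it : ℕ → Iteration N) : Prop :=
  ∀ l, IsSearchIteration I c τ (run Q ρ it l) (it l)

theorem IsSearchRun.visits_take_le (h : IsSearchRun I c τ Q ρ it) (hj : j ≤ d) (l : ℕ) :
    (run Q ρ it l).visits d (take d x) ≤ (run Q ρ it l).visits j (take j x) := by
  simp only [visits_run]
  exact selectionCount_le_selectionCount (fun n => (h n).take_mem_beam hj le_rfl) l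

/-- Evaluations and visits of a leaf may differ at first, when a rollout from a node that is not yet
expanded reaches the leaf without selecting it. -/
theorem IsSearchRun.eventuallyConst_evals_sub_visits (h : IsSearchRun I c τ Q ρ it) (x : Leaf N) :
    EventuallyConst
      (fun l => ((run Q ρ it l).evals x : ℝ) - (run Q ρ it l).visits d (take d x)) atTop := by
  obtain ⟨n, hn⟩ := eventually_atTop.1 (eventually_expanded Q ρ it)
  refine eventuallyConst_atTop_nat.2 ⟨n, fun m hm => ?_⟩
  rw [run, (h m).evals_step (hn m hm)]
  simp only [step, Nat.cast_add]
  ring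

open scoped Classical in
theorem IsSearchRun.eventuallyConst_reward_sub_sum (h : IsSearchRun I c τ Q ρ it) (hj : j ≤ d)
    (p : Prefix N j) :
    EventuallyConst (fun l => (run Q ρ it l).reward j p -
      ∑ x ∈ I with take j x = p, ∑ k ∈ Finset.range ((run Q ρ it l).evals x), ρ x k) atTop := by
  obtain ⟨n, hn⟩ := eventually_atTop.1 (eventually_expanded Q ρ it)
  refine eventuallyConst_atTop_nat.2 ⟨n, fun m hm => ?_⟩
  have hsum : ∀ x, ∑ k ∈ Finset.range ((run Q ρ it (m + 1)).evals x), ρ x k =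
      ∑ k ∈ Finset.range ((run Q ρ it m).evals x), ρ x k +
        if take d x ∈ (it m).beam d then ρ x ((run Q ρ it m).evals x) else 0 := by
    intro x
    rw [run, (h m).evals_step (hn m hm)]
    split_ifs
    · rw [Finset.sum_range_succ]
    · simp
  simp only [hsum, Finset.sum_add_distrib]
  rw [run, (h m).reward_step (hn m hm) ρ hj, add_sub_add_right_eq_sub]

theorem IsSearchRun.isBigO_evals (h : IsSearchRun I c τ Q ρ it) (hj : j ≤ d) (x : Leaf N) :
    (fun l => ((run Q ρ it l).evals x : ℝ)) =O[atTop]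
      fun l => ((run Q ρ it l).visits j (take j x) : ℝ) + 1 := by
  obtain ⟨C, hC⟩ := eventuallyConst_iff_exists_eventuallyEq.1 (h.eventuallyConst_evals_sub_visits x)
  refine IsBigO.of_bound (|C| + 1) (hC.mono fun l hl => ?_)
  have hle : ((run Q ρ it l).visits d (take d x) : ℝ) ≤ (run Q ρ it l).visits j (take j x) := by
    exact_mod_cast h.visits_take_le hj l
  simp only at hl
  rw [Real.norm_natCast, Real.norm_of_nonneg (by positivity)]
  nlinarith [le_abs_self C, abs_nonneg C]

theorem IsSearchRun.isBigO_reward (h : IsSearchRun I c τ Q ρ it)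
    (hT : ∀ x ∈ I, Tendsto (fun n : ℕ => (∑ k ∈ Finset.range n, ρ x k) / n) atTop (𝓝 (T x)))
    (hj : j ≤ d) (p : Prefix N j) :
    (fun l => (run Q ρ it l).reward j p) =O[atTop]
      fun l => ((run Q ρ it l).visits j p : ℝ) + 1 := by
  classical
  obtain ⟨C, hC⟩ :=
    eventuallyConst_iff_exists_eventuallyEq.1 (h.eventuallyConst_reward_sub_sum hj p)
  have hconst : (fun _ : ℕ => C) =O[atTop] fun l => ((run Q ρ it l).visits j p : ℝ) + 1 :=
    IsBigO.of_bound |C| (Eventually.of_forall fun l => by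
      rw [Real.norm_eq_abs, Real.norm_of_nonneg (by positivity)]
      exact le_mul_of_one_le_right (abs_nonneg C) (by simp))
  have hsum : (fun l => ∑ x ∈ I with take j x = p,
      ∑ k ∈ Finset.range ((run Q ρ it l).evals x), ρ x k) =O[atTop]
        fun l => ((run Q ρ it l).visits j p : ℝ) + 1 := by
    refine IsBigO.fun_sum fun x hx => ?_
    obtain ⟨hxI, rfl⟩ := Finset.mem_filter.1 hx
    have htop := isBigO_top_natCast_of_tendsto_div (u := fun n => ∑ k ∈ Finset.range n, ρ x k)
      (by simp) (hT x hxI)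
    exact (htop.comp_tendsto tendsto_top).trans (h.isBigO_evals hj x)
  exact (hconst.add hsum).congr' (hC.mono fun l hl => (sub_eq_iff_eq_add.1 hl).symm)
    EventuallyEq.rfl

theorem IsSearchRun.exists_abs_reward_div_visits_le (h : IsSearchRun I c τ Q ρ it)
    (hT : ∀ x ∈ I, Tendsto (fun n : ℕ => (∑ k ∈ Finset.range n, ρ x k) / n) atTop (𝓝 (T x)))
    (hj : j ≤ d) :
    ∃ W, ∀ l p, |(run Q ρ it l).reward j p / (run Q ρ it l).visits j p| ≤ W := by
  choose W hW using fun p => exists_abs_div_le_of_isBigO_add_one (h.isBigO_reward hT hj p)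
  obtain ⟨M, hM⟩ := Finite.exists_le W
  exact ⟨M, fun l p => (hW p l).trans (hM p)⟩

theorem IsSearchRun.favorsStarved (h : IsSearchRun I c τ Q ρ it) (hc : 0 < c) (hτ : 1 ≤ τ)
    (hj : j < d) {W : ℝ}
    (hW : ∀ l p, |(run Q ρ it l).reward (j + 1) p / (run Q ρ it l).visits (j + 1) p| ≤ W) :
    FavorsStarved parent (layer I (j + 1) : Set (Prefix N (j + 1)))
      (fun n => (it n).beam (j + 1)) (fun n => (it n).beam j) ((4 * W / c) ^ 2) where
  subset_node t _ ha := (mem_candidates.1 ((h t).subset j hj ha)).1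
  favors L hL t a ha hpar hpos hst := by
    simp only [← visits_run Q ρ it] at hpos hst ⊢
    obtain ⟨b, hb, hab⟩ := (h t).exists_ucb_le hτ hj (mem_candidates.2 ⟨ha, hpar, Or.inr hpos⟩)
    exact ⟨b, hb, hst.of_ucb_le hc (hW t) hL hab⟩

theorem IsSearchRun.tendsto_visits (h : IsSearchRun I c τ Q ρ it) (hc : 0 < c) (hτ : 1 ≤ τ)
    (hT : ∀ x ∈ I, Tendsto (fun n : ℕ => (∑ k ∈ Finset.range n, ρ x k) / n) atTop (𝓝 (T x)))
    (hj : j ≤ d) (hx : x ∈ I) :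
    Tendsto (fun l => (run Q ρ it l).visits j (take j x)) atTop atTop := by
  classical
  simp only [visits_run]
  induction j with
  | zero =>
    have hroot : ∀ l, selectionCount (fun n => (it n).beam 0) l (take 0 x) = l := fun l => by
      simp [selectionCount, (h _).root]
    simp only [hroot]
    exact tendsto_id
  | succ j ih =>
    obtain ⟨W, hW⟩ := h.exists_abs_reward_div_visits_le hT hj
    exact (h.favorsStarved hc hτ hj hW).tendsto_selectionCount (Finset.mem_image_of_mem _ hx)
      (ih (by lia))

theorem IsSearchRun.tendsto_estimate (h : IsSearchRun I c τ Q ρ it) (hc : 0 < c) (hτ : 1 ≤ τ)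
    (hT : ∀ x ∈ I, Tendsto (fun n : ℕ => (∑ k ∈ Finset.range n, ρ x k) / n) atTop (𝓝 (T x)))
    (hx : x ∈ I) : Tendsto (fun l => estimate (run Q ρ it l) x) atTop (𝓝 (T x)) := by
  classical
  have hvisits := h.tendsto_visits hc hτ hT le_rfl hx
  have hconst := h.eventuallyConst_evals_sub_visits x
  have hevals : Tendsto (fun l => ((run Q ρ it l).evals x : ℝ)) atTop atTop :=
    tendsto_atTop_of_eventuallyConst_sub (tendsto_natCast_atTop_atTop.comp hvisits) hconst
  have hleaf : (I.filter fun y => take d y = take d x) = {x} := by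
    ext y
    simp only [Finset.mem_filter, take_depth_injective.eq_iff, Finset.mem_singleton]
    exact ⟨And.right, fun hyx => ⟨hyx ▸ hx, hyx⟩⟩
  have hreward := h.eventuallyConst_reward_sub_sum le_rfl (take d x)
  simp only [hleaf, Finset.sum_singleton] at hreward
  have haverage := tendsto_div_of_eventuallyConst_sub hevals hreward
    ((hT x hx).comp (tendsto_natCast_atTop_iff.1 hevals))
  have hratio : Tendsto (fun l => ((run Q ρ it l).visits d (take d x) : ℝ) /
      (run Q ρ it l).evals x) atTop (𝓝 1) :=
    tendsto_div_of_eventuallyConst_sub hevals (by simpa [Function.comp_def] using hconst.comp (-·))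
      (tendsto_const_nhds.congr' ((hevals.eventually_ne_atTop 0).mono fun l hl =>
        (div_self hl).symm))
  rw [← div_one (T x)]
  refine (haverage.div hratio one_ne_zero).congr' ?_
  filter_upwards [hevals.eventually_ne_atTop 0, hvisits.eventually_gt_atTop 0] with l he hv
  rw [Pi.div_apply, div_div_div_cancel_right₀ he, estimate, if_neg hv.ne']

end Search

end TTTS

theorem theorem3_general {d : ℕ} {N : Fin d → ℕ} (I : Finset (TTTS.Leaf N)) (hI : I.Nonempty)
    (T Q : TTTS.Leaf N → ℝ) (c : ℝ) (hc : 0 < c) (τ : ℕ) (hτ : 1 ≤ τ)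
    {Ω : Type*} [MeasurableSpace Ω] (μ : Measure Ω) (R : TTTS.Leaf N → ℕ → Ω → ℝ)
    (hR : ∀ᵐ ω ∂μ, ∀ x ∈ I,
      Tendsto (fun n : ℕ => (∑ k ∈ Finset.range n, R x k ω) / n) atTop (𝓝 (T x)))
    (it : ℕ → Ω → TTTS.Iteration N) (S : ℕ → Ω → TTTS.State N)
    (hS : ∀ l ω, S l ω = TTTS.run Q (fun x k => R x k ω) (fun n => it n ω) l)
    (hit : ∀ᵐ ω ∂μ, ∀ l, TTTS.IsSearchIteration I c τ (S l ω) (it l ω)) :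
    (∀ᵐ ω ∂μ,
      (∀ j ≤ d, ∀ p ∈ TTTS.layer I j, Tendsto (fun l => (S l ω).visits j p) atTop atTop) ∧
      Tendsto (fun l => I.sup' hI fun x => |TTTS.estimate (S l ω) x - T x|) atTop (𝓝 0) ∧
      ∀ᶠ l in atTop, ∀ x ∈ I,
        IsMaxOn (TTTS.estimate (S l ω)) (I : Set (TTTS.Leaf N)) x →
          IsMaxOn T (I : Set (TTTS.Leaf N)) x) ∧
    ∀ (ρ : TTTS.Leaf N → ℕ → ℝ) (h : ℕ → TTTS.Iteration N) (l j : ℕ),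
      (TTTS.run Q ρ h l).visits = (TTTS.run (fun _ => 0) ρ h l).visits ∧
      ∀ p : TTTS.Prefix N (j + 1),
        TTTS.ucb c (TTTS.run Q ρ h l) j p =
          TTTS.ucb c (TTTS.run (fun _ => 0) ρ h l) j p +
            ((TTTS.completionSum Q (j + 1) p /
              (TTTS.run Q ρ h l).visits (j + 1) p : ℝ) : EReal) := by
  refine ⟨?_, fun ρ h l j => ⟨TTTS.visits_run_eq Q ρ h l, TTTS.ucb_run_eq Q ρ h c l j⟩⟩
  simp only [hS] at hit ⊢
  filter_upwards [hR, hit] with ω hT (hrun : TTTS.IsSearchRun I c τ Q _ _)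
  have hlim := fun x hx => hrun.tendsto_estimate hc hτ hT (x := x) hx
  refine ⟨fun j hj p hp => ?_, TTTS.tendsto_sup'_abs_sub hI hlim,
    TTTS.eventually_isMaxOn_of_tendsto hlim⟩
  obtain ⟨x, hx, rfl⟩ := Finset.mem_image.1 hp
  exact hrun.tendsto_visits hc hτ hT hj hx

theorem theorem3 {d : ℕ} {N : Fin d → ℕ}
    -- the tree, its true leaf values, the tensor-train value model, and the search parameters
    (I : Finset (TTTS.Leaf N)) (hI : I.Nonempty) (T : TTTS.Leaf N → ℝ) (M : TTTS.TTModel N)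
    (c : ℝ) (hc : 0 < c) (τ : ℕ) (hτ : 1 ≤ τ)
    -- `R x k` is the outcome of the evaluation number `k` of the leaf `x`
    {Ω : Type*} [MeasurableSpace Ω] (μ : Measure Ω) [IsProbabilityMeasure μ]
    (R : TTTS.Leaf N → ℕ → Ω → ℝ)
    (hint : ∀ x ∈ I, Integrable (R x 0) μ)
    (hindep : ∀ x ∈ I, Pairwise fun k m => IndepFun (R x k) (R x m) μ)
    (hident : ∀ x ∈ I, ∀ k, IdentDistrib (R x k) (R x 0) μ μ)
    (hmean : ∀ x ∈ I, ∫ ω, R x 0 ω ∂μ = T x)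
    -- a random run of the search, initialized with the tensor-train model
    (it : ℕ → Ω → TTTS.Iteration N) (S : ℕ → Ω → TTTS.State N)
    (hS : ∀ l ω, S l ω = TTTS.run M.eval (fun x k => R x k ω) (fun n => it n ω) l)
    (hit : ∀ᵐ ω ∂μ, ∀ l, TTTS.IsSearchIteration I c τ (S l ω) (it l ω)) :
    -- almost surely: every node is visited infinitely often, the value estimates converge uniformly
    -- to the true values, and eventually every maximizer of the estimates is a global maximizer
    (∀ᵐ ω ∂μ,
      (∀ j ≤ d, ∀ p ∈ TTTS.layer I j, Tendsto (fun l => (S l ω).visits j p) atTop atTop) ∧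
      Tendsto (fun l => I.sup' hI fun x => |TTTS.estimate (S l ω) x - T x|) atTop (𝓝 0) ∧
      ∀ᶠ l in atTop, ∀ x ∈ I,
        IsMaxOn (TTTS.estimate (S l ω)) (I : Set (TTTS.Leaf N)) x →
          IsMaxOn T (I : Set (TTTS.Leaf N)) x) ∧
    -- for the same history, initialization with the model and with zero give the same visit counts,
    -- and the upper confidence bounds differ only in the exploitation term, by the initial value
    -- over the visit count
    ∀ (ρ : TTTS.Leaf N → ℕ → ℝ) (h : ℕ → TTTS.Iteration N) (l j : ℕ),
      (TTTS.run M.eval ρ h l).visits = (TTTS.run (fun _ => 0) ρ h l).visits ∧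
      ∀ p : TTTS.Prefix N (j + 1),
        TTTS.ucb c (TTTS.run M.eval ρ h l) j p =
          TTTS.ucb c (TTTS.run (fun _ => 0) ρ h l) j p +
            ((TTTS.completionSum M.eval (j + 1) p /
              (TTTS.run M.eval ρ h l).visits (j + 1) p : ℝ) : EReal) := by
  exact theorem3_general I hI T M.eval c hc τ hτ μ R
    (TTTS.ae_tendsto_average I.countable_toSet hint hindep hident hmean) it S hS hit
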